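/- A ternary linear code of length $n$ and dimension $k$ (an $[n,k]$ code) is a $k$-dimensional subspace $C\subseteq\mathbb F_3^n$. The weight of a vector is the number of its nonzero coordinates, and the minimum weight $d(C)$ of a nonzero code $C$ is the least weight of its nonzero codewords. The dual code is $C^\perp=\{x\in\mathbb F_3^n : x\cdot y=0\text{ for all }y\in C\}$, where $x\cdot y=\sum_i x_iy_i$, and the dual distance $d^\perp$ of $C$ is $d(C^\perp)$. The code $C$ is LCD (linear complementary dual) if $C\cap C^\perp=\{0\}$. An LCD $[n,k]$ code is optimal if its minimum weight is the largest among the minimum weights of all ternary LCD $[n,k]$ codes. Two codes $C_1,C_2\subseteq\mathbb F_3^n$ are equivalent if $C_2=\{cP : c\in C_1\}$ for some $n\times n$ monomial matrix $P$ over $\mathbb F_3$ (a product of an invertible diagonal matrix and a permutation matrix). **Proposition.** 1. For every integer $s\ge 1$, there are exactly $2$ equivalence classes of ternary optimal LCD $[4s,2]$ codes with dual distance $d^\perp\ge 2$. 2. For every $t\in\{1,2\}$ and every integer $s\ge 1$, there is, up to equivalence, exactly one ternary optimal LCD $[4s+t,2]$ code with dual distance $d^\perp\ge 2$. 3. For every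 integer $s\ge 2$, there are exactly $3$ equivalence classes of ternary optimal LCD $[4s+3,2]$ codes with dual distance $d^\perp\ge 2$. -/

import Mathlib

open scoped Matrix

namespace LCD

variable {F : Type*} [Field F] {n : ℕ}

/-- A linear code of length `n` over `F` is a subspace of `F^n`. -/
abbrev Code (F : Type*) [Field F] (n : ℕ) := Submodule F (Fin n → F)

/-- The dual code `{x | x · y = 0 for all y ∈ C}` for the standard inner product. -/
def Code.dual (C : Code F n) : Code F n where
  carrier := {x | ∀ y ∈ C, x ⬝ᵥ y = 0}
  add_mem' := fun ha hb y hy => by rw [add_dotProduct, ha y hy, hb y hy, add_zero]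
  zero_mem' := fun y _ => zero_dotProduct y
  smul_mem' := fun c x hx y hy => by rw [smul_dotProduct, hx y hy, smul_zero]

/-- `C` meets its dual trivially. -/
def Code.IsLCD (C : Code F n) : Prop := C ⊓ C.dual = ⊥

/-- The minimum weight of the nonzero codewords; it is a natural number for every nonzero code,
and `⊤` for the zero code. -/
noncomputable def Code.minWeight [DecidableEq F] (C : Code F n) : ℕ∞ :=
  ⨅ c ∈ {c : Fin n → F | c ∈ C ∧ c ≠ 0}, (hammingNorm c : ℕ∞)

/-- The dual distance: the minimum weight of the dual code. -/
noncomputable def Code.dualDistance [DecidableEq F] (C : Code F n) : ℕ∞ := C.dual.minWeight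

/-- `C` is an LCD `[n, k, d]` code. -/
def Code.IsLCDWith [DecidableEq F] (C : Code F n) (k d : ℕ) : Prop :=
  C.IsLCD ∧ Module.finrank F C = k ∧ C.minWeight = (d : ℕ∞)

/-- `C` is an optimal LCD `[n, k]` code: it is an LCD `[n, k, d]` code, where `d` is the largest
minimum weight among all LCD `[n, k]` codes over `F`. -/
def Code.IsOptimalLCD [DecidableEq F] (C : Code F n) (k : ℕ) : Prop :=
  ∃ d : ℕ, C.IsLCDWith k d ∧ IsGreatest {d' : ℕ | ∃ C' : Code F n, C'.IsLCDWith k d'} d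

/-- A monomial matrix: the product of an invertible diagonal matrix and a permutation matrix. -/
def IsMonomial (P : Matrix (Fin n) (Fin n) F) : Prop :=
  ∃ (u : Fin n → Fˣ) (σ : Equiv.Perm (Fin n)),
    P = Matrix.diagonal (fun i => (u i : F)) * σ.permMatrix F

/-- Equivalence of codes: `C₂ = {cP | c ∈ C₁}` for some monomial matrix `P`. -/
def Code.Equivalent (C₁ C₂ : Code F n) : Prop :=
  ∃ P : Matrix (Fin n) (Fin n) F, IsMonomial P ∧
    (C₂ : Set (Fin n → F)) = {x | ∃ c ∈ C₁, x = c ᵥ* P}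

theorem IsMonomial.one : IsMonomial (1 : Matrix (Fin n) (Fin n) F) :=
  ⟨fun _ => 1, 1, by simp⟩

theorem monomial_apply (u : Fin n → Fˣ) (σ : Equiv.Perm (Fin n)) (i j : Fin n) :
    (Matrix.diagonal (fun i => (u i : F)) * σ.permMatrix F) i j
      = if σ i = j then (u i : F) else 0 := by
  rw [Matrix.diagonal_mul]
  simp [Equiv.Perm.permMatrix, PEquiv.toMatrix_apply, eq_comm]

theorem IsMonomial.mul {P Q : Matrix (Fin n) (Fin n) F} (hP : IsMonomial P) (hQ : IsMonomial Q) :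
    IsMonomial (P * Q) := by
  obtain ⟨u, σ, rfl⟩ := hP
  obtain ⟨v, τ, rfl⟩ := hQ
  refine ⟨fun i => u i * v (σ i), σ.trans τ, ?_⟩
  ext i j
  rw [Matrix.mul_apply]
  simp only [monomial_apply]
  rw [Finset.sum_eq_single (σ i) (fun x _ hx => by simp [Ne.symm hx]) (by simp)]
  by_cases h : τ (σ i) = j <;> simp [h]

theorem IsMonomial.exists_inv {P : Matrix (Fin n) (Fin n) F} (hP : IsMonomial P) :
    ∃ Q, IsMonomial Q ∧ P * Q = 1 := by
  obtain ⟨u, σ, rfl⟩ := hP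
  refine ⟨_, ⟨fun i => (u (σ.symm i))⁻¹, σ.symm, rfl⟩, ?_⟩
  ext i j
  rw [Matrix.mul_apply]
  simp only [monomial_apply]
  rw [Finset.sum_eq_single (σ i) (fun x _ hx => by simp [Ne.symm hx]) (by simp)]
  simp [Matrix.one_apply]

theorem Code.Equivalent.refl (C : Code F n) : C.Equivalent C :=
  ⟨1, IsMonomial.one, by ext x; simp⟩

theorem Code.Equivalent.symm {C₁ C₂ : Code F n} (h : C₁.Equivalent C₂) : C₂.Equivalent C₁ := by
  obtain ⟨P, hP, h⟩ := h
  obtain ⟨Q, hQ, hPQ⟩ := hP.exists_inv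
  refine ⟨Q, hQ, ?_⟩
  ext x
  simp only [Set.mem_ofPred_eq, SetLike.mem_coe]
  simp only [← SetLike.mem_coe (p := C₂), h, Set.mem_ofPred_eq]
  constructor
  · intro hx
    exact ⟨x ᵥ* P, ⟨x, hx, rfl⟩, by simp [hPQ]⟩
  · rintro ⟨_, ⟨c, hc, rfl⟩, rfl⟩
    simpa [hPQ] using hc

theorem Code.Equivalent.trans {C₁ C₂ C₃ : Code F n} (h₁ : C₁.Equivalent C₂)
    (h₂ : C₂.Equivalent C₃) : C₁.Equivalent C₃ := by
  obtain ⟨P, hP, h₁⟩ := h₁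
  obtain ⟨Q, hQ, h₂⟩ := h₂
  refine ⟨P * Q, hP.mul hQ, ?_⟩
  rw [h₂]
  ext x
  simp only [Set.mem_ofPred_eq]
  simp only [← SetLike.mem_coe (p := C₂), h₁, Set.mem_ofPred_eq]
  constructor
  · rintro ⟨_, ⟨c, hc, rfl⟩, rfl⟩
    exact ⟨c, hc, by simp⟩
  · rintro ⟨c, hc, rfl⟩
    exact ⟨_, ⟨c, hc, rfl⟩, by simp⟩

/-- The optimal LCD `[n, k]` codes over `F` with dual distance at least `2`. -/
def OptimalCode (F : Type*) [Field F] [DecidableEq F] (n k : ℕ) : Type _ :=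
  {C : Code F n // C.IsOptimalLCD k ∧ 2 ≤ C.dualDistance}

/-- Equivalence of codes, on the optimal LCD `[n, k]` codes with dual distance at least `2`. -/
def optimalSetoid (F : Type*) [Field F] [DecidableEq F] (n k : ℕ) : Setoid (OptimalCode F n k) where
  r C₁ C₂ := C₁.1.Equivalent C₂.1
  iseqv := ⟨fun C => Code.Equivalent.refl C.1, fun h => h.symm, fun h₁ h₂ => h₁.trans h₂⟩

/-- The number of equivalence classes of optimal LCD `[n, k]` codes over `F` with dual distance
at least `2`. -/
noncomputable def numOptimal (F : Type*) [Field F] [DecidableEq F] (n k : ℕ) : ℕ :=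
  Nat.card (Quotient (optimalSetoid F n k))

end LCD

namespace LCD

variable {n : ℕ}

/-! Each column of a 2×n generator matrix is zero or, up to sign, one of the four points of the
projective line over `ZMod 3`. Monomial maps permute columns and change signs, so the multiplicities
of these points determine the code up to equivalence. A change of basis acts on the points through
PGL(2,3), which is all of S₄ (`exists_gen_perm`, `mult_eq_of_equivalent`). Dual distance at least 2
means no zero column, so equivalence classes are sorted quadruples with sum n.

A nonzero codeword vanishes on the zero columns and on one point (`hammingNorm_combination`), so
without zero columns the minimum weight is n minus the largest multiplicity. The Gram determinant is
the symmetric function `e2` of the multiplicities (`gram_det`), so LCD means `e2 ≠ 0`. The problem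
becomes a count of quadruples (`numOptimal_eq_ncard`).

Pigeonhole bounds the largest multiplicity below by ⌈n/4⌉. For n = 4s and 4s+3 the quadruples
attaining this have `e2 = 0`, so the optimum is one worse. Modulo 3, `e2` is invariant under adding
a constant to all entries; only the deficits from the maximum matter, and they form a partition of
4, 3, 2 or 5 into at most three parts. -/

/-- The code spanned by two vectors. -/
def gen (r s : Fin n → ZMod 3) : Code (ZMod 3) n := Submodule.span (ZMod 3) {r, s}

theorem mem_gen {r s x : Fin n → ZMod 3} : x ∈ gen r s ↔ ∃ a b : ZMod 3, a • r + b • s = x :=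
  Submodule.mem_span_pair

/-! ### Column classes, the Gram determinant and the LCD condition -/

/-- The class of a vector `(x, y)`: `none` for the zero vector, and otherwise one of the four
points of the projective line over the field with three elements. -/
def pointClass (x y : ZMod 3) : Option (Fin 4) :=
  if x = 0 ∧ y = 0 then none
  else if y = 0 then some 0
  else if x = 0 then some 1
  else if x = y then some 2
  else some 3

/-- The number of coordinates at which the columns of the generator matrix with rows `r`, `s`
have a given class. -/
def mult (r s : Fin n → ZMod 3) (o : Option (Fin 4)) : ℕ :=
  (Finset.univ.filter fun i => pointClass (r i) (s i) = o).card

/-- The second elementary symmetric polynomial of four multiplicities, modulo three. -/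
def e2 (c : Fin 4 → ℕ) : ZMod 3 :=
  c 0 * c 1 + c 0 * c 2 + c 0 * c 3 + c 1 * c 2 + c 1 * c 3 + c 2 * c 3

/-- The point of the projective line orthogonal to a nonzero vector. -/
def orthPoint (a b : ZMod 3) : Fin 4 :=
  if b = 0 then 1 else if a = 0 then 0 else if a = b then 3 else 2

theorem sum_mult (r s : Fin n → ZMod 3) :
    mult r s none + ∑ p, mult r s (some p) = n := by
  have h := Finset.card_eq_sum_card_fiberwise (s := (Finset.univ : Finset (Fin n)))
    (t := Finset.univ) (f := fun i => pointClass (r i) (s i)) (fun _ _ => Finset.mem_coe.2 (Finset.mem_univ _))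
  rw [Fintype.sum_option] at h
  simpa [mult] using h.symm

theorem cast_mult (r s : Fin n → ZMod 3) (o : Option (Fin 4)) :
    (mult r s o : ZMod 3) = ∑ i, if pointClass (r i) (s i) = o then 1 else 0 := by
  simp [mult]

theorem dotProduct_self_left (r s : Fin n → ZMod 3) :
    r ⬝ᵥ r = mult r s (some 0) + mult r s (some 2) + mult r s (some 3) := by
  simp only [cast_mult, ← Finset.sum_add_distrib, dotProduct]
  refine Finset.sum_congr rfl fun i _ => ?_
  generalize r i = x
  generalize s i = y
  revert x y
  decide

theorem dotProduct_self_right (r s : Fin n → ZMod 3) :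
    s ⬝ᵥ s = mult r s (some 1) + mult r s (some 2) + mult r s (some 3) := by
  simp only [cast_mult, ← Finset.sum_add_distrib, dotProduct]
  refine Finset.sum_congr rfl fun i _ => ?_
  generalize r i = x
  generalize s i = y
  revert x y
  decide

theorem dotProduct_rows (r s : Fin n → ZMod 3) :
    r ⬝ᵥ s = mult r s (some 2) - mult r s (some 3) := by
  simp only [cast_mult, ← Finset.sum_sub_distrib, dotProduct]
  refine Finset.sum_congr rfl fun i _ => ?_
  generalize r i = x
  generalize s i = y
  revert x y
  decide

/-- Expanding leaves the term 4·c₂·c₃, which is c₂·c₃ modulo 3; this makes the determinant symmetric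
in the four points. -/
theorem gram_det (r s : Fin n → ZMod 3) :
    (r ⬝ᵥ r) * (s ⬝ᵥ s) - (r ⬝ᵥ s) * (r ⬝ᵥ s) = e2 (fun p => mult r s (some p)) := by
  rw [dotProduct_self_left r s, dotProduct_self_right r s, dotProduct_rows r s, e2]
  generalize (mult r s (some 0) : ZMod 3) = a
  generalize (mult r s (some 1) : ZMod 3) = b
  generalize (mult r s (some 2) : ZMod 3) = c
  generalize (mult r s (some 3) : ZMod 3) = d
  revert a b c d
  decide

theorem mem_dual_gen {r s x : Fin n → ZMod 3} :
    x ∈ (gen r s).dual ↔ x ⬝ᵥ r = 0 ∧ x ⬝ᵥ s = 0 := by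
  constructor
  · intro h
    exact ⟨h r (Submodule.subset_span (by simp)), h s (Submodule.subset_span (by simp))⟩
  · rintro ⟨h₁, h₂⟩ y hy
    obtain ⟨a, b, rfl⟩ := mem_gen.1 hy
    simp [dotProduct_add, dotProduct_smul, h₁, h₂]

theorem exists_kernel_of_det_eq_zero : ∀ A B D : ZMod 3, A * D - B * B = 0 →
    ∃ a b : ZMod 3, (a ≠ 0 ∨ b ≠ 0) ∧ a * A + b * B = 0 ∧ a * B + b * D = 0 := by decide

theorem kernel_of_det_ne_zero : ∀ A B D : ZMod 3, A * D - B * B ≠ 0 →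
    ∀ a b : ZMod 3, a * A + b * B = 0 → a * B + b * D = 0 → a = 0 ∧ b = 0 := by decide

/-- Coefficient vectors of codewords in the dual form the kernel of the Gram matrix. -/
theorem isLCD_gen_iff {r s : Fin n → ZMod 3} (hi : LinearIndependent (ZMod 3) ![r, s]) :
    (gen r s).IsLCD ↔ e2 (fun p => mult r s (some p)) ≠ 0 := by
  rw [← gram_det, Code.IsLCD, Submodule.eq_bot_iff]
  rw [LinearIndependent.pair_iff] at hi
  constructor
  · intro h h0
    obtain ⟨a, b, hab, h₁, h₂⟩ := exists_kernel_of_det_eq_zero _ _ _ h0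
    have := hi a b (h _ ⟨mem_gen.2 ⟨a, b, rfl⟩, mem_dual_gen.2 ⟨by
      simpa [add_dotProduct, smul_dotProduct, dotProduct_comm s r] using h₁, by
      simpa [add_dotProduct, smul_dotProduct] using h₂⟩⟩)
    tauto
  · rintro h x ⟨hx, hd⟩
    obtain ⟨a, b, rfl⟩ := mem_gen.1 hx
    obtain ⟨h₁, h₂⟩ := mem_dual_gen.1 hd
    simp only [add_dotProduct, smul_dotProduct, smul_eq_mul, dotProduct_comm s r] at h₁ h₂
    obtain ⟨rfl, rfl⟩ := kernel_of_det_ne_zero _ _ _ h a b h₁ h₂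
    simp

theorem linearIndependent_of_e2_ne_zero {r s : Fin n → ZMod 3}
    (h : e2 (fun p => mult r s (some p)) ≠ 0) : LinearIndependent (ZMod 3) ![r, s] := by
  rw [← gram_det] at h
  rw [LinearIndependent.pair_iff]
  intro a b hab
  have h₁ : (a • r + b • s) ⬝ᵥ r = 0 := by rw [hab, zero_dotProduct]
  have h₂ : (a • r + b • s) ⬝ᵥ s = 0 := by rw [hab, zero_dotProduct]
  simp only [add_dotProduct, smul_dotProduct, smul_eq_mul, dotProduct_comm s r] at h₁ h₂
  exact kernel_of_det_ne_zero _ _ _ h a b h₁ h₂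

theorem finrank_gen {r s : Fin n → ZMod 3} (hi : LinearIndependent (ZMod 3) ![r, s]) :
    Module.finrank (ZMod 3) (gen r s) = 2 := by
  have := finrank_span_eq_card hi
  rwa [Matrix.range_cons, Matrix.range_cons, Matrix.range_empty, Set.union_empty,
    Set.singleton_union, Fintype.card_fin] at this

theorem exists_gen_of_finrank {C : Code (ZMod 3) n} (h : Module.finrank (ZMod 3) C = 2) :
    ∃ r s, LinearIndependent (ZMod 3) ![r, s] ∧ C = gen r s := by
  let b := Module.finBasisOfFinrankEq (ZMod 3) C h
  have hi : LinearIndependent (ZMod 3) ![(b 0 : Fin n → ZMod 3), (b 1 : Fin n → ZMod 3)] := by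
    have h₁ := b.linearIndependent.map' C.subtype C.ker_subtype
    have h₂ : C.subtype ∘ b = ![(b 0 : Fin n → ZMod 3), (b 1 : Fin n → ZMod 3)] := by
      ext i : 1
      fin_cases i <;> rfl
    rwa [h₂] at h₁
  refine ⟨b 0, b 1, hi, (Submodule.eq_of_le_of_finrank_eq ?_ ?_).symm⟩
  · refine Submodule.span_le.2 ?_
    rintro x (rfl | rfl) <;> exact Subtype.mem _
  · rw [finrank_gen hi, h]

/-! ### Weights and dual distance -/

theorem combination_eq_zero_iff : ∀ a b : ZMod 3, (a ≠ 0 ∨ b ≠ 0) → ∀ x y : ZMod 3,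
    (a * x + b * y = 0 ↔
      pointClass x y = none ∨ pointClass x y = some (orthPoint a b)) := by decide

theorem hammingNorm_combination (r s : Fin n → ZMod 3) {a b : ZMod 3} (h : a ≠ 0 ∨ b ≠ 0) :
    hammingNorm (a • r + b • s) + (mult r s none + mult r s (some (orthPoint a b))) = n := by
  have h₁ : mult r s none + mult r s (some (orthPoint a b)) =
      (Finset.univ.filter fun i => ¬ (a • r + b • s) i ≠ 0).card := by
    rw [mult, mult, ← Finset.card_union_of_disjoint]
    · congr 1
      ext i
      simp [combination_eq_zero_iff a b h, -not_or]
    · rw [Finset.disjoint_filter]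
      intro i _ h₁ h₂
      simp [h₁] at h₂
  rw [h₁, hammingNorm, Finset.card_filter_add_card_filter_not]
  simp

theorem exists_orthPoint : ∀ p : Fin 4, ∃ a b : ZMod 3, (a ≠ 0 ∨ b ≠ 0) ∧ orthPoint a b = p := by
  decide

theorem le_minWeight_gen_iff {r s : Fin n → ZMod 3} (hi : LinearIndependent (ZMod 3) ![r, s])
    (d : ℕ) : (d : ℕ∞) ≤ (gen r s).minWeight ↔
      ∀ p, mult r s none + mult r s (some p) + d ≤ n := by
  rw [LinearIndependent.pair_iff] at hi
  simp only [Code.minWeight, le_iInf_iff, Nat.cast_le]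
  constructor
  · intro h p
    obtain ⟨a, b, hab, rfl⟩ := exists_orthPoint p
    have h₁ := h (a • r + b • s) ⟨mem_gen.2 ⟨a, b, rfl⟩, fun h0 => by
      have := hi a b h0
      tauto⟩
    have h₂ := hammingNorm_combination r s hab
    omega
  · rintro h x ⟨hx, hx0⟩
    obtain ⟨a, b, rfl⟩ := mem_gen.1 hx
    have hab : a ≠ 0 ∨ b ≠ 0 := by
      by_contra! hab
      simp [hab.1, hab.2] at hx0
    have h₁ := h (orthPoint a b)
    have h₂ := hammingNorm_combination r s hab
    omega

theorem minWeight_gen_eq_iff {r s : Fin n → ZMod 3} (hi : LinearIndependent (ZMod 3) ![r, s])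
    (hm : Monotone fun p => mult r s (some p)) (d : ℕ) :
    (gen r s).minWeight = (d : ℕ∞) ↔ mult r s none + mult r s (some 3) + d = n := by
  have hle (e : ℕ) : (e : ℕ∞) ≤ (gen r s).minWeight ↔
      mult r s none + mult r s (some 3) + e ≤ n := by
    rw [le_minWeight_gen_iff hi]
    refine ⟨fun h => h 3, fun h p => ?_⟩
    have : mult r s (some p) ≤ mult r s (some 3) := hm (Fin.le_last p)
    omega
  constructor
  · intro h
    have h₁ := (hle d).1 h.ge
    -- Equality is tested by two thresholds: `d` is a lower bound and `d + 1` is not.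
    have h₂ := mt (hle (d + 1)).2 (by rw [h, Nat.cast_le]; omega)
    omega
  · intro h
    refine le_antisymm ?_ ((hle d).2 h.le)
    refine Order.le_of_lt_add_one ?_
    rw [← not_le]
    have := mt (hle (d + 1)).1 (by omega)
    rwa [Nat.cast_add, Nat.cast_one] at this

/-- A weight-one vector supported at `i` is in the dual exactly when column `i` vanishes. -/
theorem two_le_dualDistance_gen_iff {r s : Fin n → ZMod 3} :
    2 ≤ (gen r s).dualDistance ↔ mult r s none = 0 := by
  have hc : ∀ x y : ZMod 3, pointClass x y = none ↔ x = 0 ∧ y = 0 := by decide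
  rw [mult, Finset.card_eq_zero, Finset.filter_eq_empty_iff]
  simp only [Code.dualDistance, Code.minWeight, le_iInf_iff, hc]
  constructor
  · rintro h i - ⟨h₁, h₂⟩
    have := h (Pi.single i 1) ⟨mem_dual_gen.2 (by simp [h₁, h₂]), by simp⟩
    have h1 : hammingNorm (Pi.single i 1 : Fin n → ZMod 3) = 1 := by
      rw [hammingNorm, Finset.card_eq_one]
      refine ⟨i, ?_⟩
      ext j
      simp [Pi.single_apply]
    rw [h1] at this
    exact absurd this (by decide)
  · rintro h x ⟨hx, hx0⟩
    by_contra hlt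
    have h2 : hammingNorm x < 2 := by
      rw [not_le] at hlt
      exact_mod_cast hlt
    have h1 : hammingNorm x = 1 := by
      have := hammingNorm_pos_iff.2 hx0
      omega
    rw [hammingNorm, Finset.card_eq_one] at h1
    obtain ⟨i, hi⟩ := h1
    have hx1 (j : Fin n) : x j ≠ 0 ↔ j = i := by
      simpa using Finset.ext_iff.1 hi j
    obtain ⟨h₁, h₂⟩ := mem_dual_gen.1 hx
    have hdot (y : Fin n → ZMod 3) : x ⬝ᵥ y = x i * y i :=
      Finset.sum_eq_single i (fun j _ hj => by
        rw [not_not.1 (mt (hx1 j).1 hj), zero_mul]) (by simp)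
    have hxi : x i ≠ 0 := (hx1 i).2 rfl
    rw [hdot] at h₁ h₂
    exact h (Finset.mem_univ i) ⟨by simpa [hxi] using h₁, by simpa [hxi] using h₂⟩

/-! ### Monomial equivalence and changes of basis -/

theorem vecMul_monomial (u : Fin n → (ZMod 3)ˣ) (σ : Equiv.Perm (Fin n)) (x : Fin n → ZMod 3)
    (i : Fin n) :
    (x ᵥ* (Matrix.diagonal (fun i => (u i : ZMod 3)) * σ.permMatrix (ZMod 3))) (σ i)
      = x i * u i := by
  simp only [Matrix.vecMul, dotProduct, monomial_apply]
  rw [Finset.sum_eq_single i (fun j _ hj => by simp [hj]) (by simp)]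
  simp

theorem exists_unit_of_pointClass_eq : ∀ x y x' y' : ZMod 3, pointClass x y = pointClass x' y' →
    ∃ u : (ZMod 3)ˣ, x' = x * u ∧ y' = y * u := by decide

theorem pointClass_mul_unit : ∀ (x y : ZMod 3) (u : (ZMod 3)ˣ),
    pointClass (x * u) (y * u) = pointClass x y := by decide

theorem gen_eq_image (r s : Fin n → ZMod 3) (P : Matrix (Fin n) (Fin n) (ZMod 3)) :
    (gen (r ᵥ* P) (s ᵥ* P) : Set (Fin n → ZMod 3)) = {x | ∃ c ∈ gen r s, x = c ᵥ* P} := by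
  ext x
  simp only [SetLike.mem_coe, mem_gen, Set.mem_ofPred_eq]
  constructor
  · rintro ⟨a, b, rfl⟩
    exact ⟨_, ⟨a, b, rfl⟩, by simp [Matrix.add_vecMul, Matrix.smul_vecMul]⟩
  · rintro ⟨_, ⟨a, b, rfl⟩, rfl⟩
    exact ⟨a, b, by simp [Matrix.add_vecMul, Matrix.smul_vecMul]⟩

/-- Match coordinates class by class; matched columns then differ by a unit, which supplies the
diagonal factor. -/
theorem equivalent_of_mult_eq {r s r' s' : Fin n → ZMod 3} (h : mult r s = mult r' s') :
    (gen r s).Equivalent (gen r' s') := by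
  have e (o : Option (Fin 4)) : Nonempty ({i // pointClass (r i) (s i) = o} ≃
      {i // pointClass (r' i) (s' i) = o}) := by
    refine Fintype.card_eq.1 ?_
    rw [Fintype.card_subtype, Fintype.card_subtype]
    exact congrFun h o
  let σ : Equiv.Perm (Fin n) := Equiv.ofFiberEquiv fun o => (e o).some
  have hσ (i : Fin n) : pointClass (r i) (s i) = pointClass (r' (σ i)) (s' (σ i)) :=
    (Equiv.ofFiberEquiv_map (fun o => (e o).some) i).symm
  choose u hu₁ hu₂ using fun i => exists_unit_of_pointClass_eq _ _ _ _ (hσ i)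
  refine ⟨_, ⟨u, σ, rfl⟩, ?_⟩
  rw [← gen_eq_image]
  congr 2 <;> ext j <;> obtain ⟨i, rfl⟩ := σ.surjective j
  · rw [vecMul_monomial, hu₁]
  · rw [vecMul_monomial, hu₂]

theorem mult_vecMul_monomial {P : Matrix (Fin n) (Fin n) (ZMod 3)} (hP : IsMonomial P)
    (r s : Fin n → ZMod 3) : mult (r ᵥ* P) (s ᵥ* P) = mult r s := by
  obtain ⟨u, σ, rfl⟩ := hP
  ext o
  refine (Finset.card_equiv σ fun i => ?_).symm
  simp only [Finset.mem_filter, Finset.mem_univ, true_and]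
  rw [vecMul_monomial, vecMul_monomial, pointClass_mul_unit]

/-- Transpositions generate S₄, so this makes every permutation of the points available by changing
basis. -/
theorem exists_swap_matrix : ∀ p q : Fin 4, ∃ a b c d : ZMod 3, a * d - b * c ≠ 0 ∧
    ∀ x y : ZMod 3, pointClass (a * x + b * y) (c * x + d * y) =
      (pointClass x y).map (Equiv.swap p q) := by decide +kernel

theorem exists_perm_of_matrix : ∀ a b c d : ZMod 3, a * d - b * c ≠ 0 →
    ∃ π : Equiv.Perm (Fin 4), ∀ x y : ZMod 3,
      pointClass (a * x + b * y) (c * x + d * y) = (pointClass x y).map π := by decide +kernel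

theorem mult_combination {r s : Fin n → ZMod 3} {a b c d : ZMod 3} {π : Equiv.Perm (Fin 4)}
    (h : ∀ x y : ZMod 3,
      pointClass (a * x + b * y) (c * x + d * y) = (pointClass x y).map π) :
    mult (a • r + b • s) (c • r + d • s) none = mult r s none ∧
    ∀ p, mult (a • r + b • s) (c • r + d • s) (some (π p)) = mult r s (some p) := by
  simp [mult, h]

theorem gen_combination (r s : Fin n → ZMod 3) {a b c d : ZMod 3} (h : a * d - b * c ≠ 0) :
    gen (a • r + b • s) (c • r + d • s) = gen r s := by
  ext x
  simp only [mem_gen]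
  constructor
  · rintro ⟨e, f, rfl⟩
    exact ⟨e * a + f * c, e * b + f * d, by module⟩
  · rintro ⟨e, f, rfl⟩
    have : ∀ a b c d e f : ZMod 3, a * d - b * c ≠ 0 →
        ∃ e' f' : ZMod 3, e' * a + f' * c = e ∧ e' * b + f' * d = f := by decide
    obtain ⟨e', f', rfl, rfl⟩ := this a b c d e f h
    exact ⟨e', f', by module⟩

theorem exists_gen_perm (r s : Fin n → ZMod 3) (π : Equiv.Perm (Fin 4)) :
    ∃ r' s', gen r' s' = gen r s ∧ ∀ p, mult r' s' (some (π p)) = mult r s (some p) := by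
  induction π using Equiv.Perm.swap_induction_on with
  | one => exact ⟨r, s, rfl, fun _ => rfl⟩
  | swap_mul π p q _ ih =>
    obtain ⟨r', s', h₁, h₂⟩ := ih
    obtain ⟨a, b, c, d, h, hc⟩ := exists_swap_matrix p q
    refine ⟨_, _, (gen_combination r' s' h).trans h₁, fun x => ?_⟩
    rw [Equiv.Perm.mul_apply, (mult_combination hc).2, h₂]

theorem linearIndependent_of_finrank_gen {r s : Fin n → ZMod 3}
    (h : Module.finrank (ZMod 3) (gen r s) = 2) : LinearIndependent (ZMod 3) ![r, s] := by
  rw [linearIndependent_iff_card_eq_finrank_span, Set.finrank, Matrix.range_cons,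
    Matrix.range_cons, Matrix.range_empty, Set.union_empty, Set.singleton_union, Fintype.card_fin]
  exact h.symm

theorem exists_monotone_gen {C : Code (ZMod 3) n} (h : Module.finrank (ZMod 3) C = 2) :
    ∃ r s, LinearIndependent (ZMod 3) ![r, s] ∧ C = gen r s ∧
      Monotone fun p => mult r s (some p) := by
  obtain ⟨r, s, -, rfl⟩ := exists_gen_of_finrank h
  let f : Fin 4 → ℕ := fun p => mult r s (some p)
  obtain ⟨r', s', h₁, h₂⟩ := exists_gen_perm r s (Tuple.sort f).symm
  refine ⟨r', s', linearIndependent_of_finrank_gen (h₁ ▸ h), h₁.symm, ?_⟩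
  have h₃ : (fun p => mult r' s' (some p)) = f ∘ Tuple.sort f := by
    ext p
    have := h₂ (Tuple.sort f p)
    rwa [Equiv.symm_apply_apply] at this
  exact h₃ ▸ Tuple.monotone_sort f

/-- After the monomial matrix is absorbed, two bases of one code remain; their transition matrix
permutes the multiplicities, and a sorted rearrangement is unique. -/
theorem mult_eq_of_equivalent {r s r' s' : Fin n → ZMod 3}
    (hi : LinearIndependent (ZMod 3) ![r', s'])
    (hm : Monotone fun p => mult r s (some p)) (hm' : Monotone fun p => mult r' s' (some p))
    (h : (gen r s).Equivalent (gen r' s')) :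
    (fun p => mult r s (some p)) = fun p => mult r' s' (some p) := by
  obtain ⟨P, hP, h⟩ := h
  rw [← gen_eq_image, SetLike.coe_set_eq] at h
  rw [← mult_vecMul_monomial hP] at hm ⊢
  generalize r ᵥ* P = v at *
  generalize s ᵥ* P = w at *
  have hr : r' ∈ gen v w := h ▸ Submodule.subset_span (by simp)
  have hs : s' ∈ gen v w := h ▸ Submodule.subset_span (by simp)
  obtain ⟨a, b, rfl⟩ := mem_gen.1 hr
  obtain ⟨c, d, rfl⟩ := mem_gen.1 hs
  have hdet : a * d - b * c ≠ 0 := by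
    intro h0
    have : ∀ a b c d : ZMod 3, a * d - b * c = 0 →
        ∃ e f : ZMod 3, (e ≠ 0 ∨ f ≠ 0) ∧ e * a + f * c = 0 ∧ e * b + f * d = 0 := by decide
    obtain ⟨e, f, hef, h₁, h₂⟩ := this a b c d h0
    have := LinearIndependent.pair_iff.1 hi e f (by
      have : e • (a • v + b • w) + f • (c • v + d • w)
          = (e * a + f * c) • v + (e * b + f * d) • w := by module
      rw [this, h₁, h₂, zero_smul, zero_smul, add_zero])
    tauto
  obtain ⟨π, hπ⟩ := exists_perm_of_matrix a b c d hdet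
  have h₂ := (mult_combination (r := v) (s := w) hπ).2
  set g : Fin 4 → ℕ := fun p => mult (a • v + b • w) (c • v + d • w) (some p)
  have hg : (fun p => mult v w (some p)) = g ∘ π := by
    ext p
    exact (h₂ p).symm
  rw [hg] at hm ⊢
  exact Tuple.unique_monotone (f := g) (σ := π) (τ := 1) hm hm'

/-! ### Reduction to counting sorted quadruples -/

theorem exists_mult_eq (c : Fin 4 → ℕ) (h : ∑ p, c p = n) :
    ∃ r s : Fin n → ZMod 3, ∀ p, mult r s (some p) = c p := by
  have hpt : ∀ p : Fin 4, ∃ x y : ZMod 3, pointClass x y = some p := by decide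
  choose x y hxy using hpt
  have e : Fin n ≃ Σ p, Fin (c p) := Fintype.equivOfCardEq (by simp [h])
  refine ⟨fun i => x (e i).1, fun i => y (e i).1, fun p => ?_⟩
  rw [mult, ← Fintype.card_subtype]
  simp only [hxy, Option.some.injEq]
  rw [Fintype.card_congr (e.subtypeEquiv (q := fun z => z.1 = p) fun _ => Iff.rfl),
    Fintype.card_congr (Equiv.sigmaSubtype p), Fintype.card_fin]

/-- The sorted multiplicities of the columns of an LCD `[n, 2, d]` code with dual distance at
least `2`. -/
def types (n d : ℕ) : Set (Fin 4 → ℕ) :=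
  {c | Monotone c ∧ ∑ p, c p = n ∧ c 3 + d = n ∧ e2 c ≠ 0}

/-- `d` bounds the minimum weights of the LCD `[n, 2]` codes, in terms of the multiplicities of
their columns. -/
def IsWeightBound (n d : ℕ) : Prop :=
  ∀ (m : ℕ) (c : Fin 4 → ℕ), m + ∑ p, c p = n → e2 c ≠ 0 → ∃ p, n < m + c p + (d + 1)

theorem le_of_isLCDWith {d d' : ℕ} (hd : IsWeightBound n d) {C : Code (ZMod 3) n}
    (hC : C.IsLCDWith 2 d') : d' ≤ d := by
  obtain ⟨hl, hf, hw⟩ := hC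
  obtain ⟨r, s, hi, rfl⟩ := exists_gen_of_finrank hf
  obtain ⟨p, hp⟩ := hd _ _ (sum_mult r s) ((isLCD_gen_iff hi).1 hl)
  have := (le_minWeight_gen_iff hi d').1 hw.ge p
  omega

theorem exists_isLCDWith {d : ℕ} {c : Fin 4 → ℕ} (hc : c ∈ types n d) :
    ∃ r s : Fin n → ZMod 3, (∀ p, mult r s (some p) = c p) ∧ (gen r s).IsLCDWith 2 d ∧
      2 ≤ (gen r s).dualDistance := by
  obtain ⟨hm, hs, hd, he⟩ := hc
  obtain ⟨r, s, h⟩ := exists_mult_eq c hs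
  have h0 : mult r s none = 0 := by
    have := sum_mult r s
    simp only [h] at this
    omega
  have hfun : (fun p => mult r s (some p)) = c := funext h
  rw [← hfun] at he
  have hi := linearIndependent_of_e2_ne_zero he
  refine ⟨r, s, h, ⟨(isLCD_gen_iff hi).2 he, finrank_gen hi, ?_⟩,
    two_le_dualDistance_gen_iff.2 h0⟩
  rw [minWeight_gen_eq_iff hi (hfun ▸ hm), h0, h]
  omega

theorem numOptimal_eq_ncard {d : ℕ} (hd : IsWeightBound n d) (hne : (types n d).Nonempty) :
    numOptimal (ZMod 3) n 2 = (types n d).ncard := by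
  -- A quadruple in `types n d` realizes the bound `d`, which is therefore the optimal minimum
  -- weight.
  have hgr : IsGreatest {d' : ℕ | ∃ C' : Code (ZMod 3) n, C'.IsLCDWith 2 d'} d := by
    obtain ⟨c, hc⟩ := hne
    obtain ⟨r, s, -, h, -⟩ := exists_isLCDWith hc
    exact ⟨⟨_, h⟩, fun d' ⟨C, hC⟩ => le_of_isLCDWith hd hC⟩
  have key (C : OptimalCode (ZMod 3) n 2) : ∃ r s, LinearIndependent (ZMod 3) ![r, s] ∧
      C.1 = gen r s ∧ mult r s none = 0 ∧ (fun p => mult r s (some p)) ∈ types n d := by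
    obtain ⟨C, ⟨d', ⟨hl, hf, hw⟩, hgr'⟩, h2⟩ := C
    obtain rfl := hgr'.unique hgr
    obtain ⟨r, s, hi, rfl, hm⟩ := exists_monotone_gen hf
    have h0 := two_le_dualDistance_gen_iff.1 h2
    have h3 := (minWeight_gen_eq_iff hi hm d').1 hw
    have h4 := sum_mult r s
    rw [h0, zero_add] at h3 h4
    exact ⟨r, s, hi, rfl, h0, hm, h4, h3, (isLCD_gen_iff hi).1 hl⟩
  choose r s hi hC h0 ht using key
  let f : Quotient (optimalSetoid (ZMod 3) n 2) → types n d :=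
    Quotient.lift (fun C => ⟨fun p => mult (r C) (s C) (some p), ht C⟩) (by
      intro C D (h : C.1.Equivalent D.1)
      rw [hC C, hC D] at h
      exact Subtype.ext (mult_eq_of_equivalent (hi D) (ht C).1 (ht D).1 h))
  rw [numOptimal, ← Nat.card_coe_set_eq]
  refine Nat.card_eq_of_bijective f ⟨?_, ?_⟩
  · rintro ⟨C⟩ ⟨D⟩ h
    refine Quotient.sound ?_
    change C.1.Equivalent D.1
    rw [hC C, hC D]
    refine equivalent_of_mult_eq (funext fun o => ?_)
    cases o with
    | none => rw [h0, h0]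
    | some p => exact congrFun (Subtype.ext_iff.1 h) p
  · rintro ⟨c, hc⟩
    obtain ⟨r', s', h₁, h₂, h₃⟩ := exists_isLCDWith hc
    let C : OptimalCode (ZMod 3) n 2 := ⟨gen r' s', ⟨d, h₂, hgr⟩, h₃⟩
    have hfun : (fun p => mult r' s' (some p)) = c := funext h₁
    refine ⟨Quotient.mk _ C, Subtype.ext ?_⟩
    refine (mult_eq_of_equivalent (r' := r') (s' := s')
      (linearIndependent_of_finrank_gen h₂.2.1) (ht C).1 (hfun ▸ hc.1) ?_).trans hfun
    rw [← hC C]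
    exact Code.Equivalent.refl _

/-! ### Enumeration of the admissible quadruples -/

theorem monotone_vec4 {a b c d : ℕ} (h₁ : a ≤ b) (h₂ : b ≤ c) (h₃ : c ≤ d) :
    Monotone ![a, b, c, d] := by
  rw [Fin.monotone_iff_le_succ]
  intro i
  fin_cases i <;> assumption

theorem mem_types_iff {n d : ℕ} {c : Fin 4 → ℕ} : c ∈ types n d ↔
    (c 0 ≤ c 1 ∧ c 1 ≤ c 2 ∧ c 2 ≤ c 3) ∧ c 0 + c 1 + c 2 + c 3 = n ∧ c 3 + d = n ∧
      e2 c ≠ 0 := by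
  rw [types, Set.mem_ofPred_eq, Fin.sum_univ_four]
  refine and_congr_left fun _ => ⟨fun h => ⟨h (by decide), h (by decide), h (by decide)⟩, ?_⟩
  rintro ⟨h₁, h₂, h₃⟩
  have := monotone_vec4 h₁ h₂ h₃
  convert this using 1
  ext i
  fin_cases i <;> rfl

theorem vec4_eq {c : Fin 4 → ℕ} {a₀ a₁ a₂ a₃ : ℕ} (h : c 0 = a₀ ∧ c 1 = a₁ ∧ c 2 = a₂ ∧ c 3 = a₃) :
    c = ![a₀, a₁, a₂, a₃] := by
  obtain ⟨rfl, rfl, rfl, rfl⟩ := h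
  ext i
  fin_cases i <;> rfl

theorem e2_vec4 {a₀ a₁ a₂ a₃ : ℕ} :
    e2 ![a₀, a₁, a₂, a₃] = a₀ * a₁ + a₀ * a₂ + a₀ * a₃ + a₁ * a₂ + a₁ * a₃ + a₂ * a₃ := rfl

theorem types_four_mul (k : ℕ) : types (4 * (k + 1)) (3 * k + 2) =
    {![k, k + 1, k + 1, k + 2], ![k, k, k + 2, k + 2]} := by
  ext c
  simp only [mem_types_iff, Set.mem_insert_iff, Set.mem_singleton_iff]
  constructor
  · rintro ⟨⟨h₁, h₂, h₃⟩, hs, hd, he⟩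
    -- The maximum is `k + 2`, so the other three deficits sum to 4: 2+1+1, 2+2, 4 and 3+1. The last
    -- two give `e2 = 0`.
    have h : (c 0 = k ∧ c 1 = k + 1 ∧ c 2 = k + 1 ∧ c 3 = k + 2) ∨
        (c 0 = k ∧ c 1 = k ∧ c 2 = k + 2 ∧ c 3 = k + 2) ∨
        (c 0 + 2 = k ∧ c 1 = k + 2 ∧ c 2 = k + 2 ∧ c 3 = k + 2) ∨
        (c 0 + 1 = k ∧ c 1 = k + 1 ∧ c 2 = k + 2 ∧ c 3 = k + 2) := by omega
    rcases h with h | h | ⟨h0, h1, h2, h3⟩ | ⟨h0, h1, h2, h3⟩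
    · exact Or.inl (vec4_eq h)
    · exact Or.inr (vec4_eq h)
    all_goals
      refine absurd ?_ he
      rw [e2, h1, h2, h3, ← h0]
      push_cast
      generalize (c 0 : ZMod 3) = x
      revert x
      decide
  · rintro (rfl | rfl)
    all_goals
      refine ⟨by simp, by simp; omega, by simp; omega, ?_⟩
      rw [e2_vec4]
      push_cast
      generalize (k : ZMod 3) = x
      revert x
      decide

theorem types_four_mul_add_one (k : ℕ) : types (4 * (k + 1) + 1) (3 * k + 3) =
    {![k, k + 1, k + 2, k + 2]} := by
  ext c
  simp only [mem_types_iff, Set.mem_singleton_iff]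
  constructor
  · rintro ⟨⟨h₁, h₂, h₃⟩, hs, hd, he⟩
    have h : (c 0 = k ∧ c 1 = k + 1 ∧ c 2 = k + 2 ∧ c 3 = k + 2) ∨
        (c 0 = k + 1 ∧ c 1 = k + 1 ∧ c 2 = k + 1 ∧ c 3 = k + 2) ∨
        (c 0 + 1 = k ∧ c 1 = k + 2 ∧ c 2 = k + 2 ∧ c 3 = k + 2) := by omega
    rcases h with h | ⟨h0, h1, h2, h3⟩ | ⟨h0, h1, h2, h3⟩
    · exact vec4_eq h
    · refine absurd ?_ he
      rw [e2, h0, h1, h2, h3]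
      push_cast
      generalize (k : ZMod 3) = x
      revert x
      decide
    · refine absurd ?_ he
      rw [e2, h1, h2, h3, ← h0]
      push_cast
      generalize (c 0 : ZMod 3) = x
      revert x
      decide
  · rintro rfl
    refine ⟨by simp, by simp; omega, by simp; omega, ?_⟩
    rw [e2_vec4]
    push_cast
    generalize (k : ZMod 3) = x
    revert x
    decide

theorem types_four_mul_add_two (k : ℕ) : types (4 * (k + 1) + 2) (3 * k + 4) =
    {![k + 1, k + 1, k + 2, k + 2]} := by
  ext c
  simp only [mem_types_iff, Set.mem_singleton_iff]
  constructor
  · rintro ⟨⟨h₁, h₂, h₃⟩, hs, hd, he⟩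
    have h : (c 0 = k + 1 ∧ c 1 = k + 1 ∧ c 2 = k + 2 ∧ c 3 = k + 2) ∨
        (c 0 = k ∧ c 1 = k + 2 ∧ c 2 = k + 2 ∧ c 3 = k + 2) := by omega
    rcases h with h | ⟨h0, h1, h2, h3⟩
    · exact vec4_eq h
    · refine absurd ?_ he
      rw [e2, h0, h1, h2, h3]
      push_cast
      generalize (k : ZMod 3) = x
      revert x
      decide
  · rintro rfl
    refine ⟨by simp, by simp; omega, by simp; omega, ?_⟩
    rw [e2_vec4]
    push_cast
    generalize (k : ZMod 3) = x
    revert x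
    decide

/-- The deficits sum to 5; 3+2 and 5 are excluded by `e2 = 0`. The partition 4+1 needs smallest
entry s − 2, hence s ≥ 2 and the shift `k + 2`. -/
theorem types_four_mul_add_three (k : ℕ) : types (4 * (k + 2) + 3) (3 * k + 7) =
    {![k + 2, k + 2, k + 3, k + 4], ![k + 1, k + 3, k + 3, k + 4],
      ![k, k + 3, k + 4, k + 4]} := by
  ext c
  simp only [mem_types_iff, Set.mem_insert_iff, Set.mem_singleton_iff]
  constructor
  · rintro ⟨⟨h₁, h₂, h₃⟩, hs, hd, he⟩
    have h : (c 0 = k + 2 ∧ c 1 = k + 2 ∧ c 2 = k + 3 ∧ c 3 = k + 4) ∨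
        (c 0 = k + 1 ∧ c 1 = k + 3 ∧ c 2 = k + 3 ∧ c 3 = k + 4) ∨
        (c 0 = k ∧ c 1 = k + 3 ∧ c 2 = k + 4 ∧ c 3 = k + 4) ∨
        (c 0 = k + 1 ∧ c 1 = k + 2 ∧ c 2 = k + 4 ∧ c 3 = k + 4) ∨
        (c 0 + 1 = k ∧ c 1 = k + 4 ∧ c 2 = k + 4 ∧ c 3 = k + 4) := by omega
    rcases h with h | h | h | ⟨h0, h1, h2, h3⟩ | ⟨h0, h1, h2, h3⟩
    · exact Or.inl (vec4_eq h)
    · exact Or.inr (Or.inl (vec4_eq h))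
    · exact Or.inr (Or.inr (vec4_eq h))
    · refine absurd ?_ he
      rw [e2, h0, h1, h2, h3]
      push_cast
      generalize (k : ZMod 3) = x
      revert x
      decide
    · refine absurd ?_ he
      rw [e2, h1, h2, h3, ← h0]
      push_cast
      generalize (c 0 : ZMod 3) = x
      revert x
      decide
  · rintro (rfl | rfl | rfl)
    all_goals
      refine ⟨by simp, by simp; omega, by simp; omega, ?_⟩
      rw [e2_vec4]
      push_cast
      generalize (k : ZMod 3) = x
      revert x
      decide

/-! ### Upper bounds on the minimum weight -/

theorem isWeightBound_four_mul (k : ℕ) : IsWeightBound (4 * (k + 1)) (3 * k + 2) := by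
  intro m c hs he
  by_contra! h
  rw [Fin.sum_univ_four] at hs
  have h0 := h 0
  have h1 := h 1
  have h2 := h 2
  have h3 := h 3
  -- A larger weight would force every `m + c p ≤ k + 1`; summing over the points gives `m = 0` and
  -- equality throughout.
  have hc : c 0 = k + 1 ∧ c 1 = k + 1 ∧ c 2 = k + 1 ∧ c 3 = k + 1 := by omega
  obtain ⟨g0, g1, g2, g3⟩ := hc
  refine he ?_
  rw [e2, g0, g1, g2, g3]
  generalize ((k + 1 : ℕ) : ZMod 3) = x
  revert x
  decide

/-- Pigeonhole alone suffices here; the LCD condition plays no role. -/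
theorem isWeightBound_four_mul_add_one (k : ℕ) :
    IsWeightBound (4 * (k + 1) + 1) (3 * k + 3) := by
  intro m c hs he
  by_contra! h
  rw [Fin.sum_univ_four] at hs
  have h0 := h 0
  have h1 := h 1
  have h2 := h 2
  have h3 := h 3
  omega

theorem isWeightBound_four_mul_add_two (k : ℕ) :
    IsWeightBound (4 * (k + 1) + 2) (3 * k + 4) := by
  intro m c hs he
  by_contra! h
  rw [Fin.sum_univ_four] at hs
  have h0 := h 0
  have h1 := h 1
  have h2 := h 2
  have h3 := h 3
  omega

theorem isWeightBound_four_mul_add_three (k : ℕ) :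
    IsWeightBound (4 * (k + 2) + 3) (3 * k + 7) := by
  intro m c hs he
  by_contra! h
  rw [Fin.sum_univ_four] at hs
  have h0 := h 0
  have h1 := h 1
  have h2 := h 2
  have h3 := h 3
  have hc : (c 0 = k + 2 ∧ c 1 = k + 3 ∧ c 2 = k + 3 ∧ c 3 = k + 3) ∨
      (c 0 = k + 3 ∧ c 1 = k + 2 ∧ c 2 = k + 3 ∧ c 3 = k + 3) ∨
      (c 0 = k + 3 ∧ c 1 = k + 3 ∧ c 2 = k + 2 ∧ c 3 = k + 3) ∨
      (c 0 = k + 3 ∧ c 1 = k + 3 ∧ c 2 = k + 3 ∧ c 3 = k + 2) := by omega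
  rcases hc with ⟨g0, g1, g2, g3⟩ | ⟨g0, g1, g2, g3⟩ | ⟨g0, g1, g2, g3⟩ | ⟨g0, g1, g2, g3⟩
  all_goals
    refine he ?_
    rw [e2, g0, g1, g2, g3]
    push_cast
    generalize (k : ZMod 3) = x
    revert x
    decide

/-! ### The class counts -/

theorem numOptimal_four_mul (k : ℕ) : numOptimal (ZMod 3) (4 * (k + 1)) 2 = 2 := by
  rw [numOptimal_eq_ncard (isWeightBound_four_mul k) (by simp [types_four_mul]), types_four_mul,
    Set.ncard_pair]
  intro h
  simpa using congrFun h 1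

theorem numOptimal_four_mul_add_one (k : ℕ) : numOptimal (ZMod 3) (4 * (k + 1) + 1) 2 = 1 := by
  rw [numOptimal_eq_ncard (isWeightBound_four_mul_add_one k) (by simp [types_four_mul_add_one]),
    types_four_mul_add_one, Set.ncard_singleton]

theorem numOptimal_four_mul_add_two (k : ℕ) : numOptimal (ZMod 3) (4 * (k + 1) + 2) 2 = 1 := by
  rw [numOptimal_eq_ncard (isWeightBound_four_mul_add_two k) (by simp [types_four_mul_add_two]),
    types_four_mul_add_two, Set.ncard_singleton]

theorem numOptimal_four_mul_add_three (k : ℕ) :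
    numOptimal (ZMod 3) (4 * (k + 2) + 3) 2 = 3 := by
  rw [numOptimal_eq_ncard (isWeightBound_four_mul_add_three k)
    (by simp [types_four_mul_add_three]), types_four_mul_add_three, Set.ncard_eq_three]
  refine ⟨_, _, _, fun h => ?_, fun h => ?_, fun h => ?_, rfl⟩
  all_goals simpa using congrFun h 0

end LCD

theorem mainTheorem9 :
    (∀ s : ℕ, 1 ≤ s → LCD.numOptimal (ZMod 3) (4 * s) 2 = 2) ∧
    (∀ t : ℕ, t = 1 ∨ t = 2 → ∀ s : ℕ, 1 ≤ s → LCD.numOptimal (ZMod 3) (4 * s + t) 2 = 1) ∧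
    (∀ s : ℕ, 2 ≤ s → LCD.numOptimal (ZMod 3) (4 * s + 3) 2 = 3) := by
  refine ⟨fun s hs => ?_, fun t ht s hs => ?_, fun s hs => ?_⟩
  · obtain ⟨k, rfl⟩ := Nat.exists_eq_add_of_le' hs
    exact LCD.numOptimal_four_mul k
  · obtain ⟨k, rfl⟩ := Nat.exists_eq_add_of_le' hs
    obtain rfl | rfl := ht
    · exact LCD.numOptimal_four_mul_add_one k
    · exact LCD.numOptimal_four_mul_add_two k
  · obtain ⟨k, rfl⟩ := Nat.exists_eq_add_of_le' hs
    exact LCD.numOptimal_four_mul_add_three k
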